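/- **Setting.** Let $I=\{1,2\}$, $\bar 1=2$, $\bar 2=1$. For $\iota\in I$ let $H_\iota$ be a complex Hilbert space with a distinguished unit vector $\xi_\iota$, put $H_\iota^0=H_\iota\ominus\mathbb C\xi_\iota$, and let $$\mathcal H=\mathbb C\xi\oplus\bigoplus_{n\ge 1}\ \bigoplus_{\iota_1\ne\iota_2\ne\dots\ne\iota_n}H^0_{\iota_1}\otimes\dots\otimes H^0_{\iota_n}$$ be their Hilbert space free product, with unit vacuum vector $\xi$. For $n\ge1$ let $\mathcal H^{(n)}(\iota)$ be the sum of the tensor products of order $n$ with $\iota_1\ne\iota$, and put $\mathcal H^{(0)}(\iota)=\mathbb C\xi$. For $n\ge 1$ let $P_\iota(n)$ be the orthogonal projection of $\mathcal H$ onto $\mathcal H^{(n-1)}(\iota)\oplus\mathcal H^{(n)}(\bar\iota)$, and let $$\mathcal K_\iota=\bigoplus_{n\ \mathrm{odd}}\bigl(\mathcal H^{(n-1)}(\iota)\oplus\mathcal H^{(n)}(\bar\iota)\bigr)\subset\mathcal H .$$ Let $a_\iota\in B(H_\iota)$, $\iota\in I$, be arbitrary bounded operators. Let $X_\iota=\lambda(a_\iota)\in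 B(\mathcal H)$, where $\lambda$ is the free product representation: $X_\iota=V_\iota(a_\iota\otimes 1)V_\iota^{-1}$ with the unitary $V_\iota:H_\iota\otimes\bigoplus_{n\ge0}\mathcal H^{(n)}(\iota)\to\mathcal H$, $V_\iota(h\otimes f)=\langle h,\xi_\iota\rangle f+h^0\otimes f$, where $h^0$ is the projection of $h$ onto $H_\iota^0$ and $h^0\otimes\xi$ is identified with $h^0$. Put $x_\iota(j)=P_\iota(j)X_\iota P_\iota(j)-P_\iota(j)$ for $j\ge1$, and define the following operators on $\mathcal K_\iota$ (series in the strong operator topology, with summands restricted to $\mathcal K_\iota$): $$R_\iota^{\mathrm{odd}}=1+\sum_{j\ \mathrm{odd}}x_\iota(j),\qquad R_{\bar\iota}^{\mathrm{even}}=1+\sum_{j\ge 2\ \mathrm{even}}x_{\bar\iota}(j).$$ Here $1=1_{\mathcal K_\iota}$. Let $P_\xi$ be the projection of $\mathcal K_\iota$ onto $\mathbb C\xi$. **s-freeness.** Let $\mathcal A$ be a unital complex algebra with linear functionals $\varphi,\psi$ such that $\varphi(1)=\psi(1)=1$. Let $\mathcal A_1\subset\mathcal A$ be a unital subalgebra and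 $\mathcal A_2\subset\mathcal A$ a not necessarily unital subalgebra with an internal unit $1_2\in\mathcal A_2$, i.e. $1_2b=b=b1_2$ for all $b\in\mathcal A_2$. Put $\mathcal A_1^0=\mathcal A_1\cap\ker\varphi$ and $\mathcal A_2^0=\mathcal A_2\cap\ker\psi$. The pair $(\mathcal A_1,\mathcal A_2)$ is *s-free* with respect to $(\varphi,\psi)$ if $\psi(1_2)=1$ and 1. $\varphi(b_1b_2\cdots b_n)=0$ whenever $n\ge1$, $b_k\in\mathcal A^0_{i_k}$ and $i_1\neq i_2\neq\dots\neq i_n$; 2. $\varphi(w_11_2w_2)=\varphi(w_1w_2)-\varphi(w_1)\varphi(w_2)$ for all $w_1,w_2\in\mathrm{alg}(\mathcal A_1,\mathcal A_2)$. A pair $(a,b)$ of elements of $\mathcal A$ is *s-free* with respect to $(\varphi,\psi)$, with internal unit $1_2\in\mathcal A$ of the second variable, if $(\mathrm{alg}(1,a),\mathrm{alg}(1_2,b))$ is s-free with respect to $(\varphi,\psi)$, with internal unit $1_2$; it is *s-free* if this holds for some $1_2\in\mathcal A$. **Proposition 8.2.** Let $\iota\in I$, let $\zeta\in H_\iota^0\subset\mathcal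 K_\iota$ be any unit vector, and let $\varphi(a)=\langle a\xi,\xi\rangle$ and $\psi(a)=\langle a\zeta,\zeta\rangle$ for $a\in\mathcal A=B(\mathcal K_\iota)$. Then the pair $$\bigl(R_\iota^{\mathrm{odd}}-1,\ R_{\bar\iota}^{\mathrm{even}}-1\bigr)$$ is s-free with respect to $(\varphi,\psi)$, and the internal unit of the second variable can be taken to be $1_2=1-P_\xi$. -/

import Mathlib

universe u

set_option maxSynthPendingDepth 3

namespace FreeProd

open scoped TensorProduct
open UniformSpace

noncomputable section

/-- A complex Hilbert space, as a bundled object. -/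
structure HilbSpace : Type (u + 1) where
  carrier : Type u
  [normed : NormedAddCommGroup carrier]
  [innerProduct : InnerProductSpace ℂ carrier]
  [complete : CompleteSpace carrier]

attribute [instance] HilbSpace.normed HilbSpace.innerProduct HilbSpace.complete

instance : CoeSort HilbSpace.{u} (Type u) := ⟨HilbSpace.carrier⟩

/-- A complex Hilbert space with a distinguished unit vector. -/
structure PointedHilbertSpace : Type (u + 1) extends HilbSpace.{u} where
  vec : carrier
  norm_vec : ‖vec‖ = 1

instance : CoeSort PointedHilbertSpace.{u} (Type u) := ⟨fun H => H.carrier⟩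

/-- `H⁰ = H ⊖ ℂ ξ`. -/
abbrev PointedHilbertSpace.compl (H : PointedHilbertSpace.{u}) : Submodule ℂ H :=
  (ℂ ∙ H.vec)ᗮ

variable (H : Fin 2 → PointedHilbertSpace.{u})

/-- The Hilbert space tensor product `H⁰_{i₁} ⊗ ⋯ ⊗ H⁰_{iₙ}` attached to the word `[i₁, …, iₙ]`:
one-dimensional for the empty word, and for `i :: w` the completion of the algebraic tensor product
of `H⁰_i` with the space of `w`, with its tensor product inner product. -/
def wordSpace : List (Fin 2) → HilbSpace.{u}
  | [] => ⟨EuclideanSpace ℂ PUnit.{u + 1}⟩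
  | i :: w => ⟨Completion ((H i).compl ⊗[ℂ] (wordSpace w))⟩

/-- Alternating words in the two letters `0, 1`, that is, `i₁ ≠ i₂ ≠ ⋯ ≠ iₙ`. The empty word is
included. -/
abbrev Word : Type := {w : List (Fin 2) // w.IsChain (· ≠ ·)}

/-- The Hilbert space free product: the Hilbert direct sum, over all alternating words, of the
corresponding tensor products. The empty word contributes the vacuum line `ℂ ξ`. -/
abbrev FreeFock : Type u := lp (fun w : Word => wordSpace H w.1) 2


/-- The canonical isometry `H⁰_i ⊗ (algebraic) T_w → T_{i :: w}`. -/
def wordTensor (i : Fin 2) (w : List (Fin 2)) :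
    ((H i).compl ⊗[ℂ] (wordSpace H w)) →ₗᵢ[ℂ] wordSpace H (i :: w) :=
  Completion.toComplₗᵢ

theorem denseRange_wordTensor (i : Fin 2) (w : List (Fin 2)) :
    DenseRange (wordTensor H i w) :=
  Completion.denseRange_coe

theorem norm_wordTensor_tmul {i : Fin 2} {w : List (Fin 2)} (h : (H i).compl)
    (v : wordSpace H w) : ‖wordTensor H i w (h ⊗ₜ[ℂ] v)‖ = ‖h‖ * ‖v‖ := by
  rw [LinearIsometry.norm_map, TensorProduct.norm_tmul]

theorem inner_wordTensor_tmul {i : Fin 2} {w : List (Fin 2)} (h h' : (H i).compl)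
    (v v' : wordSpace H w) :
    inner ℂ (wordTensor H i w (h ⊗ₜ[ℂ] v)) (wordTensor H i w (h' ⊗ₜ[ℂ] v')) =
      inner ℂ h h' * inner ℂ v v' := by
  rw [LinearIsometry.inner_map_map, TensorProduct.inner_tmul]

/-- Coordinates of the creation operator: the `(ι :: w)`-coordinate of the result is `h ⊗ f_w`,
all coordinates at words not starting with `ι` vanish. -/
def createFun {ι : Fin 2} (h : (H ι).compl) (f : (w : Word) → wordSpace H w.1) :
    (w : Word) → wordSpace H w.1
  | ⟨[], _⟩ => 0
  | ⟨i :: w, hw⟩ =>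
      wordTensor H i w ((Pi.single ι h : (j : Fin 2) → (H j).compl) i ⊗ₜ[ℂ] f ⟨w, hw.tail⟩)

/-- Alternating words that do not start with `ι`. -/
def Word.avoid (ι : Fin 2) : Set Word := {w | w.1.head? ≠ some ι}

/-- Put the letter `ι` in front of a word that does not start with `ι`. -/
abbrev Word.cons (ι : Fin 2) (w : Word.avoid ι) : Word :=
  ⟨ι :: w.1.1, List.isChain_cons.2
    ⟨fun i hi hι => w.2 (hι ▸ hi), w.1.2⟩⟩

theorem Word.cons_injective (ι : Fin 2) : Function.Injective (Word.cons ι) := by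
  intro a b h
  have := congrArg Subtype.val h
  simp only [List.cons.injEq, true_and] at this
  exact Subtype.ext (Subtype.ext this)

variable {H}

theorem createFun_cons {ι : Fin 2} (h : (H ι).compl) (f : (w : Word) → wordSpace H w.1)
    (w : Word.avoid ι) :
    createFun H h f (Word.cons ι w) =
      wordTensor H ι w.1.1 (h ⊗ₜ[ℂ] f w.1) := by
  simp only [createFun, Word.cons, Pi.single_eq_same]

theorem createFun_eq_zero {ι : Fin 2} (h : (H ι).compl) (f : (w : Word) → wordSpace H w.1)
    (w : Word) (hw : w ∉ Set.range (Word.cons ι)) : createFun H h f w = 0 := by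
  match w, hw with
  | ⟨[], _⟩, _ => rfl
  | ⟨i :: w, hc⟩, hw =>
    have hi : i ≠ ι := by
      rintro rfl
      exact hw ⟨⟨⟨w, hc.tail⟩, fun h' => (List.isChain_cons.1 hc).1 i h' rfl⟩, rfl⟩
    simp only [createFun, Pi.single_eq_of_ne hi, TensorProduct.zero_tmul, map_zero]

theorem memlp_createFun {ι : Fin 2} (h : (H ι).compl) (f : FreeFock H) :
    Memℓp (createFun H h f) 2 := by
  refine memℓp_gen ?_
  refine ((Word.cons_injective ι).summable_iff ?_).1 ?_
  · intro w hw
    rw [createFun_eq_zero h _ w hw]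
    simp
  · have hf := ((lp.memℓp f).summable (by norm_num)).comp_injective
      (Subtype.val_injective (p := fun w => w ∈ Word.avoid ι))
    refine (hf.mul_left (‖h‖ ^ (2 : ENNReal).toReal)).congr fun w => ?_
    simp only [Function.comp_apply]
    rw [createFun_cons, norm_wordTensor_tmul, Real.mul_rpow (norm_nonneg _) (norm_nonneg _)]

/-- The left creation operator `f ↦ h ⊗ f` for `h ∈ H⁰_ι`; it vanishes on tensors starting in `H⁰_ι`. -/
def create {ι : Fin 2} (h : (H ι).compl) (f : FreeFock H) : FreeFock H :=
  ⟨createFun H h f, memlp_createFun h f⟩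

theorem create_ext {ι : Fin 2} {a b : FreeFock H}
    (h0 : ∀ w, w ∉ Set.range (Word.cons ι) → a w = b w)
    (h1 : ∀ w : Word.avoid ι, a (Word.cons ι w) = b (Word.cons ι w)) : a = b := by
  ext w
  by_cases hw : w ∈ Set.range (Word.cons ι)
  · obtain ⟨v, rfl⟩ := hw
    exact h1 v
  · exact h0 w hw

theorem create_cons {ι : Fin 2} (h : (H ι).compl) (f : FreeFock H) (w : Word.avoid ι) :
    create h f (Word.cons ι w) =
      wordTensor H ι w.1.1 (h ⊗ₜ[ℂ] f w.1) :=
  createFun_cons h f w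

theorem create_eq_zero {ι : Fin 2} (h : (H ι).compl) (f : FreeFock H)
    (w : Word) (hw : w ∉ Set.range (Word.cons ι)) : create h f w = 0 :=
  createFun_eq_zero h f w hw

/-- The left creation operator as a bilinear map. -/
def createₗ (ι : Fin 2) : (H ι).compl →ₗ[ℂ] FreeFock H →ₗ[ℂ] FreeFock H :=
  LinearMap.mk₂ ℂ create
    (fun h h' f => by
      refine create_ext (ι := ι) (fun w hw => ?_) fun w => ?_
      · rw [lp.coeFn_add, Pi.add_apply]; simp only [create_eq_zero _ _ w hw, add_zero]
      · rw [lp.coeFn_add, Pi.add_apply]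
        simp only [create_cons, TensorProduct.add_tmul, map_add])
    (fun c h f => by
      refine create_ext (ι := ι) (fun w hw => ?_) fun w => ?_
      · rw [lp.coeFn_smul, Pi.smul_apply]; simp only [create_eq_zero _ _ w hw, smul_zero]
      · rw [lp.coeFn_smul, Pi.smul_apply]
        simp only [create_cons, ← TensorProduct.smul_tmul', map_smul])
    (fun h f f' => by
      refine create_ext (ι := ι) (fun w hw => ?_) fun w => ?_
      · rw [lp.coeFn_add, Pi.add_apply]; simp only [create_eq_zero _ _ w hw, add_zero]
      · rw [lp.coeFn_add, Pi.add_apply]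
        simp only [create_cons, lp.coeFn_add, Pi.add_apply, TensorProduct.tmul_add, map_add])
    (fun c h f => by
      refine create_ext (ι := ι) (fun w hw => ?_) fun w => ?_
      · rw [lp.coeFn_smul, Pi.smul_apply]; simp only [create_eq_zero _ _ w hw, smul_zero]
      · rw [lp.coeFn_smul, Pi.smul_apply]
        simp only [create_cons, lp.coeFn_smul, Pi.smul_apply, TensorProduct.tmul_smul, map_smul])

/-- The closed subspace of `FreeFock H` which is the Hilbert direct sum of the tensor products attached
to the words in `S`. -/
def supported (H : Fin 2 → PointedHilbertSpace.{u}) (S : Set Word) : Submodule ℂ (FreeFock H) where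
  carrier := {f | ∀ w, w ∉ S → f w = 0}
  add_mem' := by
    intro a b ha hb w hw
    rw [lp.coeFn_add, Pi.add_apply, ha w hw, hb w hw, add_zero]
  zero_mem' := fun w _ => by rw [lp.coeFn_zero, Pi.zero_apply]
  smul_mem' := by
    intro c a ha w hw
    rw [lp.coeFn_smul, Pi.smul_apply, ha w hw, smul_zero]

theorem isClosed_supported (S : Set Word) : IsClosed (supported H S : Set (FreeFock H)) := by
  have : (supported H S : Set (FreeFock H)) =
      ⋂ w : Word, ⋂ _ : w ∉ S, {f : FreeFock H | f w = 0} := by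
    ext f; simp [supported]
  rw [this]
  refine isClosed_iInter fun w => isClosed_iInter fun _ => isClosed_eq ?_ continuous_const
  exact (lp.evalCLM ℂ (fun w : Word => (wordSpace H w.1 : Type u)) 2 w).continuous

instance (S : Set Word) : CompleteSpace (supported H S) :=
  (isClosed_supported S).completeSpace_coe

theorem inner_create_create {ι : Fin 2} (h h' : (H ι).compl) (f f' : supported H (Word.avoid ι)) :
    inner ℂ (create h f.1) (create h' f'.1) = inner ℂ h h' * inner ℂ f f' := by
  have e : inner ℂ f f' = inner ℂ (f : FreeFock H) (f' : FreeFock H) := rfl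
  rw [e, lp.inner_eq_tsum, lp.inner_eq_tsum,
    ← (Word.cons_injective ι).tsum_eq, ← tsum_subtype_eq_of_support_subset (s := Word.avoid ι),
    ← tsum_mul_left]
  · refine tsum_congr fun w => ?_
    rw [create_cons, create_cons]
    exact inner_wordTensor_tmul _ _ _ _ _
  · intro w hw
    by_contra h0
    exact hw (by simp only [f.2 w h0, inner_zero_left])
  · intro w hw
    by_contra h0
    exact hw (by simp only [create_eq_zero _ _ w h0, inner_zero_left])

theorem inner_create_right {ι : Fin 2} (h : (H ι).compl) (f : FreeFock H)
    (g : supported H (Word.avoid ι)) : inner ℂ (create h f) g.1 = 0 := by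
  rw [lp.inner_eq_tsum, ← tsum_zero (α := ℂ) (β := Word)]
  refine tsum_congr fun w => ?_
  by_cases hw : w ∈ Set.range (Word.cons ι)
  · obtain ⟨v, rfl⟩ := hw
    rw [g.2 _ (by simp [Word.avoid, Word.cons]), inner_zero_right]
  · rw [create_eq_zero _ _ w hw, inner_zero_left]

theorem vec_decomp (H : PointedHilbertSpace.{u}) (h : H) :
    h = inner ℂ H.vec h • H.vec + (H.compl.orthogonalProjectionOnto h : H) := by
  have h1 := Submodule.starProjection_add_starProjection_orthogonal (K := ℂ ∙ H.vec) h
  rw [Submodule.starProjection_unit_singleton ℂ H.norm_vec] at h1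
  exact h1.symm

theorem inner_decomp (H : PointedHilbertSpace.{u}) (h h' : H) :
    inner ℂ h h' = inner ℂ h H.vec * inner ℂ H.vec h' +
      inner ℂ (H.compl.orthogonalProjectionOnto h) (H.compl.orthogonalProjectionOnto h') := by
  have e : ∀ p q : H.compl, inner ℂ p q = inner ℂ (p : H) (q : H) := fun _ _ => rfl
  have o : ∀ p : H.compl, inner ℂ H.vec (p : H) = 0 := fun p =>
    Submodule.mem_orthogonal_singleton_iff_inner_right.1 p.2
  have o' : ∀ p : H.compl, inner ℂ (p : H) H.vec = 0 := fun p =>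
    Submodule.mem_orthogonal_singleton_iff_inner_left.1 p.2
  conv_lhs => rw [vec_decomp H h, vec_decomp H h']
  simp only [inner_add_left, inner_add_right, inner_smul_left, inner_smul_right, o, o',
    inner_self_eq_norm_sq_to_K, H.norm_vec, inner_conj_symm, e,
    RCLike.ofReal_one, one_pow, mul_zero, add_zero, zero_add, mul_one]
  ring

variable (H) in
/-- The linear map underlying `leftTensor`. -/
def leftTensorₗ (ι : Fin 2) : (H ι ⊗[ℂ] supported H (Word.avoid ι)) →ₗ[ℂ] FreeFock H :=
  TensorProduct.lift (LinearMap.mk₂ ℂ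
    (fun (h : H ι) (f : supported H (Word.avoid ι)) =>
      inner ℂ (H ι).vec h • (f : FreeFock H) +
        createₗ ι ((H ι).compl.orthogonalProjectionOnto h) f)
    (fun h h' f => by
      simp only [inner_add_right, map_add, LinearMap.add_apply, add_smul]; abel)
    (fun c h f => by
      simp only [inner_smul_right, map_smul, LinearMap.smul_apply, mul_smul, smul_add])
    (fun h f f' => by
      simp only [Submodule.coe_add, map_add, smul_add]; abel)
    (fun c h f => by
      simp only [Submodule.coe_smul, map_smul, smul_add]
      rw [smul_comm]))

theorem leftTensorₗ_tmul (ι : Fin 2) (h : H ι) (f : supported H (Word.avoid ι)) :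
    leftTensorₗ H ι (h ⊗ₜ[ℂ] f) = inner ℂ (H ι).vec h • (f : FreeFock H) +
        create ((H ι).compl.orthogonalProjectionOnto h) f := rfl

variable (H) in
/-- The isometry `V` from the algebraic tensor product of `H_ι` with the subspace of the free product
spanned by the words not starting with `ι` (vacuum included), into the free product:
`V (h ⊗ f) = ⟪ξ_ι, h⟫ f + h⁰ ⊗ f` with `h⁰` the projection of `h` on `H⁰_ι`. Its range is dense
(`denseRange_leftTensor`), so it extends to a unitary operator. -/
def leftTensor (ι : Fin 2) : (H ι ⊗[ℂ] supported H (Word.avoid ι)) →ₗᵢ[ℂ] FreeFock H :=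
  (leftTensorₗ H ι).isometryOfInner fun x y => by
    induction x with
    | zero => simp
    | add x x' hx hx' => simp only [map_add, inner_add_left, hx, hx']
    | tmul h f =>
      induction y with
      | zero => simp
      | add y y' hy hy' => simp only [map_add, inner_add_right, hy, hy']
      | tmul h' f' =>
        rw [leftTensorₗ_tmul, leftTensorₗ_tmul, TensorProduct.inner_tmul]
        have o := inner_create_right ((H ι).compl.orthogonalProjectionOnto h) f f'
        have o' : inner ℂ (f : FreeFock H)
            (create ((H ι).compl.orthogonalProjectionOnto h') f' : FreeFock H) = 0 := by
          rw [← inner_conj_symm, inner_create_right, map_zero]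
        have e : inner ℂ f f' = inner ℂ (f : FreeFock H) (f' : FreeFock H) := rfl
        simp only [inner_add_left, inner_add_right, inner_smul_left, inner_smul_right, o, o',
          inner_create_create, inner_decomp (H ι) h h', inner_conj_symm, e]
        ring

theorem leftTensor_tmul (ι : Fin 2) (h : H ι) (f : supported H (Word.avoid ι)) :
    leftTensor H ι (h ⊗ₜ[ℂ] f) = inner ℂ (H ι).vec h • (f : FreeFock H) +
        create ((H ι).compl.orthogonalProjectionOnto h) f := rfl

theorem single_mem_supported {S : Set Word} {w : Word} (hw : w ∈ S) (v : wordSpace H w.1) :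
    (lp.single 2 w v : FreeFock H) ∈ supported H S := by
  intro w' hw'
  rw [lp.single_apply_ne]
  rintro rfl
  exact hw' hw

theorem create_single {ι : Fin 2} (h : (H ι).compl) (w : Word.avoid ι) (v : wordSpace H w.1.1) :
    create h (lp.single 2 w.1 v : FreeFock H) =
      lp.single 2 (Word.cons ι w) (wordTensor H ι w.1.1 (h ⊗ₜ[ℂ] v)) := by
  refine create_ext (ι := ι) (fun w' hw' => ?_) fun w' => ?_
  · rw [create_eq_zero _ _ _ hw', lp.single_apply_ne]
    rintro rfl
    exact hw' ⟨w, rfl⟩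
  · rw [create_cons]
    by_cases e : w' = w
    · subst e
      rw [lp.single_apply_self, lp.single_apply_self]
    · rw [lp.single_apply_ne _ _ _ fun h' => e (Subtype.ext h'),
        lp.single_apply_ne _ _ _ fun h' => e (Word.cons_injective ι h'), TensorProduct.tmul_zero,
        map_zero]

theorem denseRange_leftTensor (ι : Fin 2) : DenseRange (leftTensor H ι) := by
  let M : Submodule ℂ (FreeFock H) := (LinearMap.range (leftTensorₗ H ι)).topologicalClosure
  have hM : IsClosed (M : Set (FreeFock H)) := Submodule.isClosed_topologicalClosure _
  have hmem : ∀ t, leftTensorₗ H ι t ∈ M := fun t =>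
    Submodule.le_topologicalClosure _ (LinearMap.mem_range_self _ t)
  have hs : ∀ (w : Word) (a : wordSpace H w.1), (lp.single 2 w a : FreeFock H) ∈ M := by
    intro w a
    by_cases hw : w ∈ Set.range (Word.cons ι)
    · obtain ⟨v, rfl⟩ := hw
      have hcl : IsClosed {a : wordSpace H (ι :: v.1.1) |
          (lp.single 2 (Word.cons ι v) a : FreeFock H) ∈ M} :=
        hM.preimage (lp.singleContinuousLinearMap ℂ
          (fun w : Word => (wordSpace H w.1 : Type u)) 2 (Word.cons ι v)).continuous
      refine (denseRange_wordTensor H ι v.1.1).induction_on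
        (p := fun a => (lp.single 2 (Word.cons ι v) a : FreeFock H) ∈ M) a hcl fun t => ?_
      induction t with
      | zero => rw [map_zero, lp.single_zero]; exact M.zero_mem
      | add t t' ht ht' => rw [map_add, lp.single_add]; exact M.add_mem ht ht'
      | tmul h x =>
        have := hmem ((h : H ι) ⊗ₜ[ℂ] ⟨lp.single 2 v.1 x, single_mem_supported v.2 x⟩)
        rw [leftTensorₗ_tmul, Submodule.orthogonalProjectionOnto_mem_subspace_eq_self,
          Submodule.mem_orthogonal_singleton_iff_inner_right.1 h.2, zero_smul, zero_add,
          create_single] at this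
        exact this
    · have hw' : w ∈ Word.avoid ι := by
        intro h
        obtain ⟨l, hl⟩ := w
        cases l with
        | nil => simp at h
        | cons i l =>
          obtain rfl : i = ι := by simpa using h
          exact hw ⟨⟨⟨l, hl.tail⟩, fun h' => (List.isChain_cons.1 hl).1 i h' rfl⟩, rfl⟩
      have := hmem ((H ι).vec ⊗ₜ[ℂ] ⟨lp.single 2 w a, single_mem_supported hw' a⟩)
      have h0 : (H ι).compl.orthogonalProjectionOnto (H ι).vec = 0 :=
        Submodule.orthogonalProjectionOnto_orthogonal_apply_eq_zero
          (Submodule.mem_span_singleton_self _)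
      have h1 : ∀ f : FreeFock H, create (0 : (H ι).compl) f = 0 := fun f => by
        have := congrArg (fun T => T f) (map_zero (createₗ (H := H) ι))
        exact this
      rw [leftTensorₗ_tmul, h0, h1, add_zero, inner_self_eq_norm_sq_to_K, (H ι).norm_vec] at this
      simpa using this
  intro f
  have : f ∈ M := hM.mem_of_tendsto (lp.hasSum_single (by norm_num) f)
    (Filter.Eventually.of_forall fun s => M.sum_mem fun w _ => hs w _)
  exact this

/-- The free product representation `λ` of `B(H_ι)`: the bounded operator `V (x ⊗ 1) V⁻¹` on the free
product (see `freeRep_leftTensor`). -/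
def freeRep (ι : Fin 2) (x : H ι →L[ℂ] H ι) : FreeFock H →L[ℂ] FreeFock H :=
  ((leftTensor H ι).toContinuousLinearMap ∘L
    x.rTensor (supported H (Word.avoid ι))).extend (leftTensor H ι).toContinuousLinearMap

theorem freeRep_leftTensor (ι : Fin 2) (x : H ι →L[ℂ] H ι)
    (t : H ι ⊗[ℂ] supported H (Word.avoid ι)) :
    freeRep ι x (leftTensor H ι t) = leftTensor H ι (x.rTensor _ t) :=
  ContinuousLinearMap.extend_eq _ (e := (leftTensor H ι).toContinuousLinearMap)
    (denseRange_leftTensor ι) (leftTensor H ι).isometry.isUniformInducing t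

theorem exists_hasSum_compression {E : Type*} [NormedAddCommGroup E] [InnerProductSpace ℂ E]
    [CompleteSpace E] (V : ℕ → Submodule ℂ E) [∀ k, CompleteSpace (V k)]
    (hV : OrthogonalFamily ℂ (fun k => V k) fun k => (V k).subtypeₗᵢ) (A : E →L[ℂ] E) :
    ∃ S : E →L[ℂ] E, ∀ f : E, HasSum (fun k => ((V k).starProjection ∘L A ∘L
      (V k).starProjection - (V k).starProjection) f) (S f) := by
  have bessel : ∀ f : E, Summable fun k => ‖(V k).orthogonalProjectionOnto f‖ ^ 2 := by
    intro f
    refine summable_of_sum_le (c := ‖f‖ ^ 2) (fun _ => sq_nonneg _) fun s => ?_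
    have h1 := hV.norm_sum (fun k => (V k).orthogonalProjectionOnto f) s
    set y : E := ∑ k ∈ s, (V k).subtypeₗᵢ ((V k).orthogonalProjectionOnto f) with hy
    have h2 : inner ℂ y f = ((‖y‖ ^ 2 : ℝ) : ℂ) := by
      rw [h1, hy, sum_inner, Complex.ofReal_sum]
      refine Finset.sum_congr rfl fun k _ => ?_
      change inner ℂ ((V k).orthogonalProjectionOnto f : E) f = _
      rw [← Submodule.inner_orthogonalProjectionOnto_eq_of_mem_left,
        inner_self_eq_norm_sq_to_K]
      push_cast
      rfl
    have h3 : ‖y‖ ^ 2 ≤ ‖y‖ * ‖f‖ := by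
      have := norm_inner_le_norm (𝕜 := ℂ) y f
      rwa [h2, Complex.norm_real, Real.norm_of_nonneg (sq_nonneg _)] at this
    rw [← h1]
    nlinarith [norm_nonneg y, norm_nonneg f, sq_nonneg (‖y‖ - ‖f‖)]
  have hsum : ∀ f : E, Summable fun k => ((V k).starProjection ∘L A ∘L
      (V k).starProjection - (V k).starProjection) f := by
    intro f
    refine (hV.summable_iff_norm_sq_summable fun k =>
      (V k).orthogonalProjectionOnto (A ((V k).orthogonalProjectionOnto f : E)) -
        (V k).orthogonalProjectionOnto f).2 ?_
    refine Summable.of_nonneg_of_le (fun _ => sq_nonneg _) (fun k => ?_)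
      ((bessel f).mul_left ((‖A‖ + 1) ^ 2))
    rw [← mul_pow]
    refine pow_le_pow_left₀ (norm_nonneg _) ?_ 2
    refine (norm_sub_le _ _).trans ?_
    rw [add_mul, one_mul]
    refine add_le_add ?_ le_rfl
    exact ((V k).norm_orthogonalProjectionOnto_apply_le _).trans (A.le_opNorm _)
  have hT : Filter.Tendsto (fun (s : Finset ℕ) (f : E) => (∑ k ∈ s, ((V k).starProjection ∘L A ∘L
      (V k).starProjection - (V k).starProjection)) f) Filter.atTop
      (nhds fun f => ∑' k, ((V k).starProjection ∘L A ∘L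
      (V k).starProjection - (V k).starProjection) f) := by
    rw [tendsto_pi_nhds]
    intro f
    have := (hsum f).hasSum
    refine this.congr fun s => ?_
    rw [sum_apply]
  exact ⟨continuousLinearMapOfTendsto _ hT, fun f => (hsum f).hasSum⟩

/-- The other index, `ῑ`. -/
abbrev bar (ι : Fin 2) : Fin 2 := ι.rev

/-- Words of length `n` that do not start with `ι`. The corresponding subspace is `ℋ^{(n)}(ι)`; for
`n = 0` it is the vacuum line. -/
def levelWords (n : ℕ) (ι : Fin 2) : Set Word := {w | w.1.length = n ∧ w.1.head? ≠ some ι}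

/-- For `n ≥ 1`, the words that make up `ℋ^{(n-1)}(ι) ⊕ ℋ^{(n)}(ῑ)`. -/
def blockWords (ι : Fin 2) (n : ℕ) : Set Word := levelWords (n - 1) ι ∪ levelWords n (bar ι)

/-- The projection `P_ι(n)` of the free product onto `ℋ^{(n-1)}(ι) ⊕ ℋ^{(n)}(ῑ)`, for `n ≥ 1`. -/
def blockProj (H : Fin 2 → PointedHilbertSpace.{u}) (ι : Fin 2) (n : ℕ) :
    FreeFock H →L[ℂ] FreeFock H := (supported H (blockWords ι n)).starProjection

/-- `X_ι(j) = P_ι(j) X_ι P_ι(j)`, where `X_ι = λ(x_ι)`. -/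
def blockX (x : (i : Fin 2) → H i →L[ℂ] H i) (ι : Fin 2) (j : ℕ) : FreeFock H →L[ℂ] FreeFock H :=
  blockProj H ι j ∘L freeRep ι (x ι) ∘L blockProj H ι j

/-- `X_ι(j) - P_ι(j)`. -/
def blockSub (x : (i : Fin 2) → H i →L[ℂ] H i) (ι : Fin 2) (j : ℕ) : FreeFock H →L[ℂ] FreeFock H :=
  blockX x ι j - blockProj H ι j

theorem supported_orthogonal {S T : Set Word} (hST : Disjoint S T) (f : supported H S)
    (g : supported H T) : inner ℂ (f : FreeFock H) (g : FreeFock H) = 0 := by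
  rw [lp.inner_eq_tsum, ← tsum_zero (α := ℂ) (β := Word)]
  refine tsum_congr fun w => ?_
  by_cases hw : w ∈ S
  · rw [g.2 w (Set.disjoint_left.1 hST hw), inner_zero_right]
  · rw [f.2 w hw, inner_zero_left]

theorem orthogonalFamily_blocks (ι : Fin 2) (m : ℕ) :
    OrthogonalFamily ℂ (fun k => supported H (blockWords ι (m + 2 * k)))
      fun k => (supported H (blockWords ι (m + 2 * k))).subtypeₗᵢ := by
  intro k l hkl f g
  refine supported_orthogonal (Set.disjoint_left.2 fun w hk hl => ?_) f g
  simp only [blockWords, levelWords, Set.mem_union, Set.mem_ofPred_eq] at hk hl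
  omega

theorem exists_hasSum_blockSub (x : (i : Fin 2) → H i →L[ℂ] H i) (ι : Fin 2) (m : ℕ) :
    ∃ S : FreeFock H →L[ℂ] FreeFock H, ∀ f, HasSum (fun k => blockSub x ι (m + 2 * k) f) (S f) :=
  exists_hasSum_compression _ (orthogonalFamily_blocks ι m) (freeRep ι (x ι))

/-- The series `∑_{j ∈ J(m)} (X_ι(j) - P_ι(j))`, `J(m) = {m, m + 2, m + 4, …}`, as a bounded operator on
the free product; it converges in the strong operator topology (`hasSum_series`). -/
def series (x : (i : Fin 2) → H i →L[ℂ] H i) (ι : Fin 2) (m : ℕ) : FreeFock H →L[ℂ] FreeFock H :=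
  (exists_hasSum_blockSub x ι m).choose

theorem hasSum_series (x : (i : Fin 2) → H i →L[ℂ] H i) (ι : Fin 2) (m : ℕ) (f : FreeFock H) :
    HasSum (fun k => blockSub x ι (m + 2 * k) f) (series x ι m f) :=
  (exists_hasSum_blockSub x ι m).choose_spec f

variable (H) in
/-- The s-free product `K_ι = ⨁_{n odd} (ℋ^{(n-1)}(ι) ⊕ ℋ^{(n)}(ῑ))`, a closed subspace of the free
product. -/
abbrev sFreeFock (ι : Fin 2) : Submodule ℂ (FreeFock H) :=
  supported H (⋃ n : {n : ℕ // Odd n}, blockWords ι n)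

variable (H) in
/-- The vacuum vector `ξ`. -/
def vacuum : FreeFock H :=
  lp.single 2 (⟨[], List.isChain_nil⟩ : Word) (EuclideanSpace.single PUnit.unit (1 : ℂ))

theorem vacuum_mem (ι : Fin 2) : vacuum H ∈ sFreeFock H ι :=
  single_mem_supported (by
    refine Set.mem_iUnion.2 ⟨⟨1, odd_one⟩, Or.inl ⟨rfl, by simp⟩⟩) _

variable (H) in
/-- The vacuum vector as a vector of `K_ι`. -/
def vacuumK (ι : Fin 2) : sFreeFock H ι := ⟨vacuum H, vacuum_mem ι⟩

/-- The operator `R_ι(m) = 1 + ∑_{j ∈ J(m)} (X_ι(j) - P_ι(j))` on `K_κ`. In use, `κ = ι` for odd `m` and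
`κ = ῑ` for even `m`; then the summands leave `K_κ` invariant, and composing with the inclusion of `K_κ`
and the orthogonal projection onto it is restricting them to `K_κ`. -/
def opR (x : (i : Fin 2) → H i →L[ℂ] H i) (κ ι : Fin 2) (m : ℕ) :
    sFreeFock H κ →L[ℂ] sFreeFock H κ :=
  1 + (sFreeFock H κ).orthogonalProjectionOnto ∘L series x ι m ∘L (sFreeFock H κ).subtypeL

/-- `R_ι^{odd} = R_ι(1)`, an operator on `K_ι`. -/
def oddR (x : (i : Fin 2) → H i →L[ℂ] H i) (ι : Fin 2) : sFreeFock H ι →L[ℂ] sFreeFock H ι :=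
  opR x ι ι 1

/-- `R_ῑ^{even} = R_ῑ(2)`, an operator on `K_ι`. -/
def evenBarR (x : (i : Fin 2) → H i →L[ℂ] H i) (ι : Fin 2) :
    sFreeFock H ι →L[ℂ] sFreeFock H ι :=
  opR x ι (bar ι) 2

variable (H) in
/-- `H⁰_ι` as a subspace of the free product: the summand of the one-letter word `ι`. -/
def letterSpace (ι : Fin 2) : Submodule ℂ (FreeFock H) := supported H {w | w.1 = [ι]}

variable (H) in
/-- The projection `P_ξ` onto the vacuum line, as an operator on `K_ι`. -/
def vacuumProj (ι : Fin 2) : sFreeFock H ι →L[ℂ] sFreeFock H ι :=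
  (ℂ ∙ vacuumK H ι).starProjection

/-- The vector functional `a ↦ ⟨a v, v⟩` (Mathlib inner products are linear in the second
variable). -/
def vectorState {E : Type*} [NormedAddCommGroup E] [InnerProductSpace ℂ E] (v : E) :
    (E →L[ℂ] E) →ₗ[ℂ] ℂ where
  toFun a := inner ℂ v (a v)
  map_add' a b := by rw [add_apply, inner_add_right]
  map_smul' c a := by rw [smul_apply, inner_smul_right]; rfl

/-- The pair `(A₁, A₂)`, with `e` the internal unit of `A₂`, is free with subordination (s-free) with
respect to `(φ, ψ)`. In the alternating products, the letter `(0, a)` stands for an element `a` of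
`A₁ ∩ ker φ` and `(1, a)` for an element of `A₂ ∩ ker ψ`. -/
structure IsSFree {A : Type*} [Ring A] [Algebra ℂ A] (φ ψ : A →ₗ[ℂ] ℂ) (A₁ : Subalgebra ℂ A)
    (A₂ : NonUnitalSubalgebra ℂ A) (e : A) : Prop where
  phi_one : φ 1 = 1
  psi_one : ψ 1 = 1
  unit_mem : e ∈ A₂
  unit_mul : ∀ b ∈ A₂, e * b = b
  mul_unit : ∀ b ∈ A₂, b * e = b
  psi_unit : ψ e = 1
  alternating : ∀ l : List (Fin 2 × A), l ≠ [] → l.IsChain (fun p q => p.1 ≠ q.1) →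
    (∀ p ∈ l, (p.1 = 0 ∧ p.2 ∈ A₁ ∧ φ p.2 = 0) ∨ (p.1 = 1 ∧ p.2 ∈ A₂ ∧ ψ p.2 = 0)) →
    φ (l.map Prod.snd).prod = 0
  insertion : ∀ w₁ ∈ Algebra.adjoin ℂ ((A₁ : Set A) ∪ (A₂ : Set A)),
    ∀ w₂ ∈ Algebra.adjoin ℂ ((A₁ : Set A) ∪ (A₂ : Set A)),
    φ (w₁ * e * w₂) = φ (w₁ * w₂) - φ w₁ * φ w₂

/-- The pair of random variables `(a, b)` is s-free with respect to `(φ, ψ)`, with internal unit `e`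
of the second variable: `(alg(1, a), alg(e, b))` is s-free. -/
def IsSFreePairWithUnit {A : Type*} [Ring A] [Algebra ℂ A] (φ ψ : A →ₗ[ℂ] ℂ) (a b e : A) : Prop :=
  IsSFree φ ψ (Algebra.adjoin ℂ {a}) (NonUnitalAlgebra.adjoin ℂ {e, b}) e

/-- The pair of random variables `(a, b)` is s-free with respect to `(φ, ψ)`. -/
def IsSFreePair {A : Type*} [Ring A] [Algebra ℂ A] (φ ψ : A →ₗ[ℂ] ℂ) (a b : A) : Prop :=
  ∃ e : A, IsSFreePairWithUnit φ ψ a b e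

end

end FreeProd

open FreeProd

namespace FreeProd

open scoped TensorProduct

noncomputable section

/-! The space `K_ι` splits along leading letters in two ways. It is `V_ι (H_ι ⊗ E)`, with `E`
spanned by the words of even length not starting with `ι`; it is also `ℂξ ⊕ V_ῑ (H_ῑ ⊗ O)`, with `O`
spanned by the words of odd length not starting with `ῑ`. Each block of the projections `P_j(n)`
contains `V_j (H_j ⊗ f)` for `f` of word length `n - 1`, so on `V_j (h ⊗ f)` the series collapses to
one term. Hence `R_ι^{odd} - 1` acts as `(a_ι - 1) ⊗ 1` in the first picture, and `R_ῑ^{even} - 1`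
acts as `0 ⊕ (a_ῑ - 1) ⊗ 1` in the second (`series_leftTensor`, `actsAs_opR_sub_one`).

The form `T ⊗ 1` survives algebra operations, so every element of either algebra has it (`ActsAs`).
Since `f = V_j (ξ_j ⊗ f)`, the vector state at any unit `f` in `E`, respectively `O`, is `⟨T ξ_j,
ξ_j⟩`. This identifies `φ` on the first algebra (`f = ξ`) and `ψ` on the second (`f = ζ`, for every
`ζ`). A centred element therefore maps `f` to the pure tensor `T ξ_j ⊗ f`, with one letter added.

An alternating product of centred elements applied to `ξ` is then zero, if the rightmost factor is
in the second algebra, or else gains a letter with every factor. In both cases the result is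
orthogonal to `ξ` (`prod_vacuumK_mem`). The insertion rule holds because `1 - 1₂` is the rank-one
projection onto `ξ`. -/

/-- The words that do not start with `j` and whose extension by the letter `j` has length in
`{m, m + 2, m + 4, …}`. -/
def tailWords (j : Fin 2) (m : ℕ) : Set Word :=
  {w | (∃ k, w.1.length + 1 = m + 2 * k) ∧ w.1.head? ≠ some j}

theorem tailWords_subset_avoid (j : Fin 2) (m : ℕ) : tailWords j m ⊆ Word.avoid j :=
  fun _ h => h.2

variable {H : Fin 2 → PointedHilbertSpace.{u}}

/-! ### Supports of created vectors -/

theorem supported_mono {S T : Set Word} (h : S ⊆ T) : supported H S ≤ supported H T :=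
  fun _ hf w hw => hf w fun hs => hw (h hs)

theorem create_mem_supported {j : Fin 2} (h : (H j).compl) {S T : Set Word} {f : FreeFock H}
    (hf : f ∈ supported H S) (hT : ∀ w : Word.avoid j, w.1 ∈ S → Word.cons j w ∈ T) :
    create h f ∈ supported H T := by
  intro w hw
  by_cases hr : w ∈ Set.range (Word.cons j)
  · obtain ⟨v, rfl⟩ := hr
    rw [create_cons, hf v.1 fun hv => hw (hT v hv), TensorProduct.tmul_zero, map_zero]
  · exact create_eq_zero h f w hr

theorem leftTensor_mem_supported {j : Fin 2} (h : H j) {S T : Set Word}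
    {f : supported H (Word.avoid j)} (hf : (f : FreeFock H) ∈ supported H S) (hS : S ⊆ T)
    (hT : ∀ w : Word.avoid j, w.1 ∈ S → Word.cons j w ∈ T) :
    leftTensor H j (h ⊗ₜ[ℂ] f) ∈ supported H T := by
  rw [leftTensor_tmul]
  exact add_mem (Submodule.smul_mem _ _ (supported_mono hS hf)) (create_mem_supported _ hf hT)

/-- This lets a vector without leading `j` be read as `ξ_j ⊗ f`, so that an operator `T ⊗ 1` can be
evaluated on it. -/
theorem leftTensor_vec_tmul (j : Fin 2) (f : supported H (Word.avoid j)) :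
    leftTensor H j ((H j).vec ⊗ₜ[ℂ] f) = f := by
  have h0 : (H j).compl.orthogonalProjectionOnto (H j).vec = 0 :=
    Submodule.orthogonalProjectionOnto_orthogonal_apply_eq_zero
      (Submodule.mem_span_singleton_self _)
  have h1 : create (0 : (H j).compl) (f : FreeFock H) = 0 :=
    congrArg (fun T => T (f : FreeFock H)) (map_zero (createₗ (H := H) j))
  rw [leftTensor_tmul, h0, h1, add_zero, inner_self_eq_norm_sq_to_K, (H j).norm_vec]
  simp

/-! ### Block projections and the strong series -/

theorem blockProj_eq_self {j : Fin 2} {n : ℕ} {f : FreeFock H}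
    (hf : f ∈ supported H (blockWords j n)) : blockProj H j n f = f :=
  Submodule.starProjection_eq_self_iff.2 hf

theorem blockProj_eq_zero {j : Fin 2} {n : ℕ} {S : Set Word} {f : FreeFock H}
    (hf : f ∈ supported H S) (hS : Disjoint (blockWords j n) S) : blockProj H j n f = 0 :=
  (Submodule.starProjection_apply_eq_zero_iff _).2 fun g hg =>
    supported_orthogonal hS ⟨g, hg⟩ ⟨f, hf⟩

theorem blockSub_mem (x : (i : Fin 2) → H i →L[ℂ] H i) (j : Fin 2) (n : ℕ) (f : FreeFock H) :
    blockSub x j n f ∈ supported H (blockWords j n) :=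
  Submodule.sub_mem _ (Submodule.starProjection_apply_mem _ _)
    (Submodule.starProjection_apply_mem _ _)

theorem series_mem (x : (i : Fin 2) → H i →L[ℂ] H i) (j : Fin 2) (m : ℕ) {T : Set Word}
    (hT : ∀ k, blockWords j (m + 2 * k) ⊆ T) (f : FreeFock H) :
    series x j m f ∈ supported H T :=
  (isClosed_supported T).mem_of_tendsto (hasSum_series x j m f)
    (Filter.Eventually.of_forall fun _ =>
      Submodule.sum_mem _ fun k _ => supported_mono (hT k) (blockSub_mem x j _ f))

theorem series_eq_zero (x : (i : Fin 2) → H i →L[ℂ] H i) (j : Fin 2) (m : ℕ) {S : Set Word}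
    {f : FreeFock H} (hf : f ∈ supported H S)
    (hS : ∀ k, Disjoint (blockWords j (m + 2 * k)) S) : series x j m f = 0 := by
  refine (hasSum_series x j m f).unique ?_
  have : (fun k => blockSub x j (m + 2 * k) f) = fun _ => 0 := by
    funext k
    simp [blockSub, blockX, blockProj_eq_zero hf (hS k)]
  rw [this]
  exact hasSum_zero

theorem disjoint_blockWords (j : Fin 2) (m : ℕ) {k l : ℕ} (h : k ≠ l) :
    Disjoint (blockWords j (m + 2 * k)) (blockWords j (m + 2 * l)) :=
  Set.disjoint_left.2 fun w hk hl => by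
    simp only [blockWords, levelWords, Set.mem_union, Set.mem_ofPred_eq] at hk hl
    omega

theorem ne_bar (j : Fin 2) : j ≠ bar j := by
  revert j; decide

/-! ### The series acts on one tensor leg -/

/-- On `V (h ⊗ f)` with `f` in the summand of a single word, exactly one term of the series
contributes. -/
theorem series_leftTensor_single (x : (i : Fin 2) → H i →L[ℂ] H i) (j : Fin 2) (m : ℕ) (h : H j)
    (w : Word) (hw : w ∈ tailWords j m) (f : supported H (Word.avoid j))
    (hf : (f : FreeFock H) ∈ supported H {w}) :
    series x j m (leftTensor H j (h ⊗ₜ[ℂ] f)) = leftTensor H j ((x j h - h) ⊗ₜ[ℂ] f) := by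
  obtain ⟨⟨k, hk⟩, hj⟩ := hw
  -- The block is fixed by the length of `w`: the `ξ_j`-component of `h'` leaves the word `w` of
  -- length `m + 2k - 1`, the rest lengthens it to `m + 2k`, and both lie in block `m + 2k`.
  have hmem : ∀ h' : H j, leftTensor H j (h' ⊗ₜ[ℂ] f) ∈
      supported H (blockWords j (m + 2 * k)) := fun h' => by
    refine leftTensor_mem_supported h' hf ?_ ?_
    · rintro _ rfl
      exact Or.inl ⟨by omega, hj⟩
    · rintro v hv
      obtain rfl : v.1 = w := hv
      refine Or.inr ⟨by simpa [Word.cons] using hk, ?_⟩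
      simpa [Word.cons] using ne_bar j
  refine (hasSum_series x j m _).unique ?_
  have e : leftTensor H j ((x j h - h) ⊗ₜ[ℂ] f) =
      blockSub x j (m + 2 * k) (leftTensor H j (h ⊗ₜ[ℂ] f)) := by
    have e1 : freeRep j (x j) (leftTensor H j (h ⊗ₜ[ℂ] f)) = leftTensor H j (x j h ⊗ₜ[ℂ] f) :=
      freeRep_leftTensor j (x j) _
    simp only [blockSub, blockX, sub_apply, ContinuousLinearMap.comp_apply,
      blockProj_eq_self (hmem _), e1, TensorProduct.sub_tmul, map_sub]
  rw [e]
  refine hasSum_single k fun l hl => ?_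
  simp [blockSub, blockX, blockProj_eq_zero (hmem h) (disjoint_blockWords j m hl)]

/-- `f ↦ V (h ⊗ f)` as a bounded operator. -/
def leftTensorCLM (j : Fin 2) (h : H j) : supported H (Word.avoid j) →L[ℂ] FreeFock H :=
  ((leftTensor H j).toLinearMap ∘ₗ TensorProduct.mk ℂ _ _ h).mkContinuous ‖h‖ fun f => by
    simp [TensorProduct.norm_tmul]

/-- Both sides are continuous in `f`, so it suffices to expand `f` over words and compare term by
term. -/
theorem series_leftTensor (x : (i : Fin 2) → H i →L[ℂ] H i) (j : Fin 2) (m : ℕ) (h : H j)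
    (f : supported H (Word.avoid j)) (hf : (f : FreeFock H) ∈ supported H (tailWords j m)) :
    series x j m (leftTensor H j (h ⊗ₜ[ℂ] f)) = leftTensor H j ((x j h - h) ⊗ₜ[ℂ] f) := by
  have hs : ∀ w : Word, (lp.single 2 w ((f : FreeFock H) w) : FreeFock H) ∈
      supported H (Word.avoid j) := fun w => by
    by_cases hw : w ∈ Word.avoid j
    · exact single_mem_supported hw _
    · rw [f.2 w hw, lp.single_zero]
      exact zero_mem _
  -- The expansion has to converge inside the subspace of vectors without leading `j`, the domain of
  -- `leftTensorCLM`; the subspace carries the induced topology.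
  have hsum : HasSum (fun w : Word => (⟨_, hs w⟩ : supported H (Word.avoid j))) f :=
    (Topology.IsInducing.subtypeVal.hasSum_iff
      (g := (supported H (Word.avoid j)).subtype) _ _).1
      (lp.hasSum_single (by norm_num) (f : FreeFock H))
  have h1 := hsum.mapL (series x j m ∘L leftTensorCLM j h)
  have h2 := hsum.mapL (leftTensorCLM j (x j h - h))
  refine h1.unique (h2.congr_fun ?_)
  intro w
  by_cases hw : w ∈ tailWords j m
  · exact series_leftTensor_single x j m h w hw _
      (single_mem_supported (Set.mem_singleton w) _)
  · have : (⟨_, hs w⟩ : supported H (Word.avoid j)) = 0 := Subtype.ext <| by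
      change (lp.single 2 w ((f : FreeFock H) w) : FreeFock H) = 0
      rw [hf w hw, lp.single_zero]
    rw [this, map_zero, map_zero]

/-! ### Operators of the form `T ⊗ 1` -/

/-- The operator `D` on `K_κ` acts as `T ⊗ 1` on the vectors `V (h ⊗ f)` of `K_κ` with `f` in the
sum of the tensor products attached to `S`. -/
def ActsAs (κ j : Fin 2) (S : Set Word) (D : sFreeFock H κ →L[ℂ] sFreeFock H κ)
    (T : H j →L[ℂ] H j) : Prop :=
  ∀ (h : H j) (f : supported H (Word.avoid j)), (f : FreeFock H) ∈ supported H S →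
    ∀ k : sFreeFock H κ, (k : FreeFock H) = leftTensor H j (h ⊗ₜ[ℂ] f) →
      (D k : FreeFock H) = leftTensor H j (T h ⊗ₜ[ℂ] f)

namespace ActsAs

variable {κ j : Fin 2} {S : Set Word} {D D' : sFreeFock H κ →L[ℂ] sFreeFock H κ}
  {T T' : H j →L[ℂ] H j}

theorem add (hD : ActsAs κ j S D T) (hD' : ActsAs κ j S D' T') :
    ActsAs κ j S (D + D') (T + T') := fun h f hf k hk => by
  rw [add_apply, add_apply, Submodule.coe_add, hD h f hf k hk, hD' h f hf k hk,
    TensorProduct.add_tmul, map_add]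

theorem smul (c : ℂ) (hD : ActsAs κ j S D T) : ActsAs κ j S (c • D) (c • T) :=
  fun h f hf k hk => by
    rw [smul_apply, smul_apply, Submodule.coe_smul, hD h f hf k hk,
      ← TensorProduct.smul_tmul', map_smul]

theorem mul (hD : ActsAs κ j S D T) (hD' : ActsAs κ j S D' T') :
    ActsAs κ j S (D * D') (T * T') := fun h f hf k hk =>
  hD (T' h) f hf (D' k) (hD' h f hf k hk)

theorem one : ActsAs (H := H) κ j S 1 1 := fun _ _ _ _ hk => hk

theorem zero : ActsAs (H := H) κ j S 0 0 := fun h f _ k _ => by simp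

theorem apply_eq_leftTensor (hD : ActsAs κ j S D T) (k : sFreeFock H κ)
    (hk : (k : FreeFock H) ∈ supported H S) (f : supported H (Word.avoid j))
    (hf : (f : FreeFock H) = k) :
    (D k : FreeFock H) = leftTensor H j (T (H j).vec ⊗ₜ[ℂ] f) :=
  hD (H j).vec f (hf ▸ hk) k (hf.symm.trans (leftTensor_vec_tmul j f).symm)

theorem apply_eq (hD : ActsAs κ j S D T) (hS : S ⊆ Word.avoid j) (k : sFreeFock H κ)
    (hk : (k : FreeFock H) ∈ supported H S) :
    (D k : FreeFock H) = inner ℂ (H j).vec (T (H j).vec) • (k : FreeFock H) +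
      create ((H j).compl.orthogonalProjectionOnto (T (H j).vec)) k :=
  (hD.apply_eq_leftTensor k hk ⟨k, supported_mono hS hk⟩ rfl).trans (leftTensor_tmul j _ _)

/-- Because `k = V (ξ_j ⊗ f)` and `V` is isometric, the value factors as `⟨T ξ_j, ξ_j⟩ ‖f‖²`. It
does not depend on which unit vector supported on `S` is chosen, which is why `ζ` can be arbitrary.
-/
theorem vectorState_eq (hD : ActsAs κ j S D T) (hS : S ⊆ Word.avoid j) (k : sFreeFock H κ)
    (hk : (k : FreeFock H) ∈ supported H S) (hn : ‖k‖ = 1) :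
    vectorState k D = inner ℂ (H j).vec (T (H j).vec) := by
  obtain ⟨f, hf⟩ : ∃ f : supported H (Word.avoid j), (f : FreeFock H) = k :=
    ⟨⟨k, supported_mono hS hk⟩, rfl⟩
  have hn' : ‖f‖ = 1 := (congrArg norm hf).trans hn
  change inner ℂ (k : FreeFock H) (D k : FreeFock H) = _
  -- Writing the left argument as `V (ξ_j ⊗ f)` too makes the isometry property of `V` applicable.
  rw [hD.apply_eq_leftTensor k hk f hf, ← hf, ← leftTensor_vec_tmul j f,
    LinearIsometry.inner_map_map, TensorProduct.inner_tmul, inner_self_eq_norm_sq_to_K, hn']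
  simp

/-- Centring removes the component along `k`, and only the creation of a letter `j` remains. -/
theorem mem_supported_of_vectorState_eq_zero (hD : ActsAs κ j S D T) (hS : S ⊆ Word.avoid j)
    (hT : inner ℂ (H j).vec (T (H j).vec) = 0) {R : Set Word}
    (hR : ∀ w : Word.avoid j, w.1 ∈ S → Word.cons j w ∈ R) (k : sFreeFock H κ)
    (hk : (k : FreeFock H) ∈ supported H S) : (D k : FreeFock H) ∈ supported H R := by
  rw [hD.apply_eq hS k hk, hT, zero_smul, zero_add]
  exact create_mem_supported _ hk hR

end ActsAs

/-! ### Words of `K_ι` and the vacuum vector -/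

theorem bar_ne (ι : Fin 2) : bar ι ≠ ι := (ne_bar ι).symm

/-- The words of `K_ι` are the `w` and `ι :: w` with `w` of even length and not starting with `ι`. -/
theorem mem_sFreeWords {ι : Fin 2} {w : Word} :
    w ∈ (⋃ n : {n : ℕ // Odd n}, blockWords ι n) ↔
      w ∈ tailWords ι 1 ∨ w ∈ tailWords (bar ι) 2 := by
  simp only [Set.mem_iUnion, blockWords, levelWords, tailWords, Set.mem_union,
    Set.mem_ofPred_eq]
  constructor
  · rintro ⟨⟨n, k, hn⟩, ⟨h, h'⟩ | ⟨h, h'⟩⟩ <;> dsimp only at h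
    · exact Or.inl ⟨⟨k, by omega⟩, h'⟩
    · exact Or.inr ⟨⟨k, by omega⟩, h'⟩
  · rintro (⟨⟨k, hk⟩, h⟩ | ⟨⟨k, hk⟩, h⟩)
    · exact ⟨⟨2 * k + 1, k, rfl⟩, Or.inl ⟨by dsimp only; omega, h⟩⟩
    · exact ⟨⟨2 * k + 1, k, rfl⟩, Or.inr ⟨by dsimp only; omega, h⟩⟩

theorem cons_mem_tailWords_two {ι : Fin 2} {w : Word.avoid ι} (hw : w.1 ∈ tailWords ι 1) :
    Word.cons ι w ∈ tailWords (bar ι) 2 := by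
  obtain ⟨⟨k, hk⟩, -⟩ := hw
  exact ⟨⟨k, by simp only [List.length_cons]; omega⟩, by simpa using ne_bar ι⟩

/-- Nonemptiness is recorded because the empty word also lies in `tailWords ι 1`, and it must be
excluded for orthogonality to `ξ`. -/
theorem cons_bar_mem_tailWords_one {ι : Fin 2} {w : Word.avoid (bar ι)}
    (hw : w.1 ∈ tailWords (bar ι) 2) :
    Word.cons (bar ι) w ∈ {w | w ∈ tailWords ι 1 ∧ w.1 ≠ []} := by
  obtain ⟨⟨k, hk⟩, -⟩ := hw
  exact ⟨⟨⟨k + 1, by simp only [List.length_cons]; omega⟩, by simpa using bar_ne ι⟩, by simp⟩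

theorem nil_notMem_blockWords {j : Fin 2} (k : ℕ) :
    (⟨[], List.isChain_nil⟩ : Word) ∉ blockWords j (2 + 2 * k) := by
  simp only [blockWords, levelWords, Set.mem_union, Set.mem_ofPred_eq, List.length_nil]
  omega

theorem vacuum_mem_supported {S : Set Word} (h : (⟨[], List.isChain_nil⟩ : Word) ∈ S) :
    vacuum H ∈ supported H S :=
  single_mem_supported h _

theorem norm_vacuumK (ι : Fin 2) : ‖vacuumK H ι‖ = 1 := by
  change ‖vacuum H‖ = 1
  refine (lp.norm_single (E := fun w : Word => wordSpace H w.1) (p := 2) (by norm_num) _ _).trans ?_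
  exact (PiLp.norm_single (p := 2) (β := fun _ : PUnit.{u + 1} => ℂ) _ _).trans (by simp)

theorem inner_vacuumK {ι : Fin 2} {k : sFreeFock H ι}
    (hk : (k : FreeFock H) ∈ supported H {w | w.1 ≠ []}) : inner ℂ (vacuumK H ι) k = 0 :=
  supported_orthogonal (S := {⟨[], List.isChain_nil⟩})
    (T := {w | w.1 ≠ []})
    (Set.disjoint_singleton_left.2 fun h : ([] : List (Fin 2)) ≠ [] => h rfl)
    ⟨vacuum H, vacuum_mem_supported (Set.mem_singleton _)⟩ ⟨k, hk⟩

/-! ### The two operators and the vacuum projection -/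

theorem opR_sub_one_apply (x : (i : Fin 2) → H i →L[ℂ] H i) (κ j : Fin 2) (m : ℕ)
    (k : sFreeFock H κ) (hk : series x j m k ∈ sFreeFock H κ) :
    (((opR x κ j m - 1) k : sFreeFock H κ) : FreeFock H) = series x j m k := by
  rw [opR, add_sub_cancel_left]
  exact Submodule.starProjection_eq_self_iff.2 hk

theorem actsAs_opR_sub_one (x : (i : Fin 2) → H i →L[ℂ] H i) (κ j : Fin 2) (m : ℕ)
    (hS : tailWords j m ⊆ ⋃ n : {n : ℕ // Odd n}, blockWords κ n)
    (hc : ∀ w : Word.avoid j, w.1 ∈ tailWords j m →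
      Word.cons j w ∈ ⋃ n : {n : ℕ // Odd n}, blockWords κ n) :
    ActsAs κ j (tailWords j m) (opR x κ j m - 1) (x j - 1) := fun h f hf k hk => by
  have e : series x j m (k : FreeFock H) = leftTensor H j ((x j h - h) ⊗ₜ[ℂ] f) := by
    rw [hk, series_leftTensor x j m h f hf]
  rw [opR_sub_one_apply, e]
  · rfl
  · rw [e]
    exact leftTensor_mem_supported _ hf hS hc

theorem actsAs_oddR_sub_one (x : (i : Fin 2) → H i →L[ℂ] H i) (ι : Fin 2) :
    ActsAs ι ι (tailWords ι 1) (oddR x ι - 1) (x ι - 1) :=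
  actsAs_opR_sub_one x ι ι 1 (fun _ h => mem_sFreeWords.2 (Or.inl h))
    fun _ h => mem_sFreeWords.2 (Or.inr (cons_mem_tailWords_two h))

theorem actsAs_evenBarR_sub_one (x : (i : Fin 2) → H i →L[ℂ] H i) (ι : Fin 2) :
    ActsAs ι (bar ι) (tailWords (bar ι) 2) (evenBarR x ι - 1) (x (bar ι) - 1) :=
  actsAs_opR_sub_one x ι (bar ι) 2 (fun _ h => mem_sFreeWords.2 (Or.inr h))
    fun _ h => mem_sFreeWords.2 (Or.inl (cons_bar_mem_tailWords_one h).1)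

theorem vacuumProj_apply (ι : Fin 2) (k : sFreeFock H ι) :
    vacuumProj H ι k = (inner ℂ (vacuumK H ι) k : ℂ) • vacuumK H ι :=
  Submodule.starProjection_unit_singleton ℂ (norm_vacuumK ι) k

theorem vacuumProj_vacuumK (ι : Fin 2) : vacuumProj H ι (vacuumK H ι) = vacuumK H ι :=
  Submodule.starProjection_eq_self_iff.2 (Submodule.mem_span_singleton_self _)

theorem vacuumProj_mul_self (ι : Fin 2) : vacuumProj H ι * vacuumProj H ι = vacuumProj H ι :=
  Submodule.isIdempotentElem_starProjection _

theorem mul_vacuumProj_eq_zero {ι : Fin 2} {D : sFreeFock H ι →L[ℂ] sFreeFock H ι}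
    (hD : D (vacuumK H ι) = 0) : D * vacuumProj H ι = 0 := by
  ext1 k
  change D (vacuumProj H ι k) = 0
  rw [vacuumProj_apply, map_smul, hD, smul_zero]

theorem series_bar_mem_sFreeFock (x : (i : Fin 2) → H i →L[ℂ] H i) (ι : Fin 2) (f : FreeFock H) :
    series x (bar ι) 2 f ∈ sFreeFock H ι := by
  refine series_mem x _ _ (fun k w hw => mem_sFreeWords.2 ?_) f
  simp only [blockWords, levelWords, Set.mem_union, Set.mem_ofPred_eq] at hw
  rcases hw with ⟨h, h'⟩ | ⟨h, h'⟩
  · exact Or.inr ⟨⟨k, by omega⟩, h'⟩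
  · exact Or.inl ⟨⟨k + 1, by omega⟩, by simpa [bar] using h'⟩

/-- The even blocks start at index `2`, so they contain only words of length at least `1` and do not
meet the vacuum. -/
theorem evenBarR_sub_one_vacuumK (x : (i : Fin 2) → H i →L[ℂ] H i) (ι : Fin 2) :
    (evenBarR x ι - 1) (vacuumK H ι) = 0 := by
  refine Subtype.ext ?_
  rw [evenBarR, opR_sub_one_apply _ _ _ _ _ (series_bar_mem_sFreeFock x ι _)]
  exact series_eq_zero x _ _ (vacuum_mem_supported (Set.mem_singleton _))
    fun k => Set.disjoint_singleton_right.2 (nil_notMem_blockWords k)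

theorem vacuumProj_mul_evenBarR_sub_one (x : (i : Fin 2) → H i →L[ℂ] H i) (ι : Fin 2) :
    vacuumProj H ι * (evenBarR x ι - 1) = 0 := by
  ext1 k
  change vacuumProj H ι ((evenBarR x ι - 1) k) = 0
  rw [vacuumProj_apply, inner_vacuumK, zero_smul]
  rw [evenBarR, opR_sub_one_apply _ _ _ _ _ (series_bar_mem_sFreeFock x ι _)]
  refine series_mem x _ _ (T := {w | w.1 ≠ []}) (fun l w hw (h : w.1 = []) => ?_) _
  obtain rfl : w = ⟨[], List.isChain_nil⟩ := Subtype.ext h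
  exact nil_notMem_blockWords l hw

theorem nil_notMem_tailWords_two (j : Fin 2) :
    (⟨[], List.isChain_nil⟩ : Word) ∉ tailWords j 2 := fun ⟨⟨k, hk⟩, _⟩ => by
  simp only [List.length_nil] at hk
  omega

theorem nil_mem_tailWords_one (j : Fin 2) : (⟨[], List.isChain_nil⟩ : Word) ∈ tailWords j 1 :=
  ⟨⟨0, rfl⟩, by simp⟩

theorem ne_nil_of_mem_tailWords_two {j : Fin 2} {w : Word} (hw : w ∈ tailWords j 2) :
    w.1 ≠ [] := fun h => by
  obtain rfl : w = ⟨[], List.isChain_nil⟩ := Subtype.ext h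
  exact nil_notMem_tailWords_two j hw

/-- Here `f` has no vacuum component, so `V (h ⊗ f)` is orthogonal to `ξ`. The internal unit thus
fits the same scheme as the other generator, with `T = 1`. -/
theorem actsAs_one_sub_vacuumProj (ι : Fin 2) :
    ActsAs (H := H) ι (bar ι) (tailWords (bar ι) 2) (1 - vacuumProj H ι) 1 := fun h f hf k hk => by
  have : vacuumProj H ι k = 0 := by
    rw [vacuumProj_apply, inner_vacuumK, zero_smul]
    rw [hk]
    exact leftTensor_mem_supported h hf (fun _ h => ne_nil_of_mem_tailWords_two h)
      fun w _ => by simp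
  rw [sub_apply, this, sub_zero]
  exact hk

/-! ### Elements of the two algebras -/

theorem exists_actsAs_of_mem_adjoin (x : (i : Fin 2) → H i →L[ℂ] H i) (ι : Fin 2)
    {D : sFreeFock H ι →L[ℂ] sFreeFock H ι} (hD : D ∈ Algebra.adjoin ℂ {oddR x ι - 1}) :
    ∃ T, ActsAs ι ι (tailWords ι 1) D T := by
  induction hD using Algebra.adjoin_induction with
  | mem D hD =>
    obtain rfl := hD
    exact ⟨_, actsAs_oddR_sub_one x ι⟩
  | algebraMap r =>
    rw [Algebra.algebraMap_eq_smul_one]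
    exact ⟨_, ActsAs.one.smul r⟩
  | add D D' _ _ h h' =>
    obtain ⟨T, hT⟩ := h
    obtain ⟨T', hT'⟩ := h'
    exact ⟨_, hT.add hT'⟩
  | mul D D' _ _ h h' =>
    obtain ⟨T, hT⟩ := h
    obtain ⟨T', hT'⟩ := h'
    exact ⟨_, hT.mul hT'⟩

/-- The two annihilation relations say that `1 - P_ξ` is a unit for the second algebra; the right
one also makes this algebra kill `ξ`, which the form `T ⊗ 1` does not see. -/
theorem exists_actsAs_of_mem_nonUnitalAdjoin (x : (i : Fin 2) → H i →L[ℂ] H i) (ι : Fin 2)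
    {D : sFreeFock H ι →L[ℂ] sFreeFock H ι}
    (hD : D ∈ NonUnitalAlgebra.adjoin ℂ {1 - vacuumProj H ι, evenBarR x ι - 1}) :
    (∃ T, ActsAs ι (bar ι) (tailWords (bar ι) 2) D T) ∧
      vacuumProj H ι * D = 0 ∧ D * vacuumProj H ι = 0 := by
  induction hD using NonUnitalAlgebra.adjoin_induction with
  | mem D hD =>
    rcases hD with rfl | hD
    · refine ⟨⟨_, actsAs_one_sub_vacuumProj ι⟩, ?_, ?_⟩
      · rw [mul_sub, mul_one, vacuumProj_mul_self, sub_self]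
      · rw [sub_mul, one_mul, vacuumProj_mul_self, sub_self]
    · obtain rfl := hD
      exact ⟨⟨_, actsAs_evenBarR_sub_one x ι⟩, vacuumProj_mul_evenBarR_sub_one x ι,
        mul_vacuumProj_eq_zero (evenBarR_sub_one_vacuumK x ι)⟩
  | zero => exact ⟨⟨_, ActsAs.zero⟩, mul_zero _, zero_mul _⟩
  | add D D' _ _ h h' =>
    obtain ⟨⟨T, hT⟩, h1, h2⟩ := h
    obtain ⟨⟨T', hT'⟩, h1', h2'⟩ := h'
    exact ⟨⟨_, hT.add hT'⟩, by rw [mul_add, h1, h1', add_zero], by rw [add_mul, h2, h2', add_zero]⟩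
  | smul r D _ h =>
    obtain ⟨⟨T, hT⟩, h1, h2⟩ := h
    exact ⟨⟨_, hT.smul r⟩, by rw [mul_smul_comm, h1, smul_zero],
      by rw [smul_mul_assoc, h2, smul_zero]⟩
  | mul D D' _ _ h h' =>
    obtain ⟨⟨T, hT⟩, h1, h2⟩ := h
    obtain ⟨⟨T', hT'⟩, h1', h2'⟩ := h'
    exact ⟨⟨_, hT.mul hT'⟩, by rw [← mul_assoc, h1, zero_mul], by rw [mul_assoc, h2', mul_zero]⟩

/-! ### Alternating products applied to the vacuum -/

/-- The words of `K_ι` in which a nonempty alternating product of centred elements, with first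
factor of type `i`, maps the vacuum. -/
def rangeWords (ι i : Fin 2) : Set Word :=
  if i = 0 then tailWords (bar ι) 2 else {w | w ∈ tailWords ι 1 ∧ w.1 ≠ []}

theorem rangeWords_subset (ι i : Fin 2) : rangeWords ι i ⊆ {w | w.1 ≠ []} := by
  intro w hw
  unfold rangeWords at hw
  split_ifs at hw
  exacts [ne_nil_of_mem_tailWords_two hw, hw.2]

/-- Induction from the rightmost factor. The words reached by a factor of one type are legitimate
second legs for the other type, so each further centred factor again creates a letter. -/
theorem prod_vacuumK_mem (x : (i : Fin 2) → H i →L[ℂ] H i) (ι : Fin 2)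
    {ζ : sFreeFock H ι} (hζ : (ζ : FreeFock H) ∈ supported H (tailWords (bar ι) 2))
    (hn : ‖ζ‖ = 1) (l : List (Fin 2 × (sFreeFock H ι →L[ℂ] sFreeFock H ι)))
    (p : Fin 2 × (sFreeFock H ι →L[ℂ] sFreeFock H ι))
    (hc : (p :: l).IsChain (fun p q => p.1 ≠ q.1))
    (hl : ∀ q ∈ p :: l, (q.1 = 0 ∧ q.2 ∈ Algebra.adjoin ℂ {oddR x ι - 1} ∧
        vectorState (vacuumK H ι) q.2 = 0) ∨
      (q.1 = 1 ∧ q.2 ∈ NonUnitalAlgebra.adjoin ℂ {1 - vacuumProj H ι, evenBarR x ι - 1} ∧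
        vectorState ζ q.2 = 0)) :
    (((p :: l).map Prod.snd).prod (vacuumK H ι) : FreeFock H) ∈
      supported H (rangeWords ι p.1) := by
  induction l generalizing p with
  | nil =>
    simp only [List.map_cons, List.map_nil, List.prod_cons, List.prod_nil, mul_one]
    rcases hl p (by simp) with ⟨h0, hp, hφ⟩ | ⟨h1, hp, -⟩
    · obtain ⟨T, hT⟩ := exists_actsAs_of_mem_adjoin x ι hp
      have hv : vacuum H ∈ supported H (tailWords ι 1) :=
        vacuum_mem_supported (nil_mem_tailWords_one ι)
      rw [hT.vectorState_eq (tailWords_subset_avoid _ _) _ hv (norm_vacuumK ι)] at hφ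
      rw [rangeWords, if_pos h0]
      exact hT.mem_supported_of_vectorState_eq_zero (tailWords_subset_avoid _ _) hφ
        (fun _ => cons_mem_tailWords_two) _ hv
    -- A rightmost factor from the second algebra kills `ξ`, so the whole product vanishes on it;
    -- centring plays no role here.
    · obtain ⟨-, -, h2⟩ := exists_actsAs_of_mem_nonUnitalAdjoin x ι hp
      have := congrArg (fun A => A (vacuumK H ι)) h2
      simp only [mul_apply_eq_comp, vacuumProj_vacuumK, zero_apply] at this
      rw [this]
      exact zero_mem _
  | cons q l ih =>
    have hq := ih q hc.tail fun r hr => hl r (List.mem_cons_of_mem _ hr)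
    have hpq : p.1 ≠ q.1 := (List.isChain_cons_cons.1 hc).1
    rw [List.map_cons, List.prod_cons, mul_apply_eq_comp]
    rcases hl p (by simp) with ⟨h0, hp, hφ⟩ | ⟨h1, hp, hψ⟩
    · obtain ⟨T, hT⟩ := exists_actsAs_of_mem_adjoin x ι hp
      rw [hT.vectorState_eq (tailWords_subset_avoid _ _) _
        (vacuum_mem_supported (nil_mem_tailWords_one ι)) (norm_vacuumK ι)] at hφ
      -- By alternation the next factor is from the second algebra, so the vector lives on nonempty
      -- words of even length not starting with `ι`.
      rw [rangeWords, if_neg fun h => hpq (h0.trans h.symm)] at hq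
      rw [rangeWords, if_pos h0]
      exact hT.mem_supported_of_vectorState_eq_zero (tailWords_subset_avoid _ _) hφ
        (fun _ => cons_mem_tailWords_two) _ (supported_mono (fun _ h => h.1) hq)
    · obtain ⟨⟨T, hT⟩, -, -⟩ := exists_actsAs_of_mem_nonUnitalAdjoin x ι hp
      rw [hT.vectorState_eq (tailWords_subset_avoid _ _) _ hζ hn] at hψ
      rw [rangeWords, if_pos (by omega)] at hq
      rw [rangeWords, if_neg (by omega)]
      exact hT.mem_supported_of_vectorState_eq_zero (tailWords_subset_avoid _ _) hψ
        (fun _ => cons_bar_mem_tailWords_one) _ hq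

/-! ### The axioms of s-freeness -/

theorem vectorState_apply {E : Type*} [NormedAddCommGroup E] [InnerProductSpace ℂ E] (v : E)
    (a : E →L[ℂ] E) : vectorState v a = inner ℂ v (a v) := rfl

theorem vectorState_one {E : Type*} [NormedAddCommGroup E] [InnerProductSpace ℂ E] {v : E}
    (hv : ‖v‖ = 1) : vectorState v 1 = 1 := by
  change inner ℂ v v = 1
  rw [inner_self_eq_norm_sq_to_K, hv]
  simp

/-- The projection onto `v` has rank one, so inserting it between `a` and `b` splits the state into
the product of the two values. -/
theorem vectorState_mul_one_sub_mul {E : Type*} [NormedAddCommGroup E] [InnerProductSpace ℂ E]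
    {v : E} (hv : ‖v‖ = 1) (a b : E →L[ℂ] E) :
    vectorState v (a * (1 - (ℂ ∙ v).starProjection) * b) =
      vectorState v (a * b) - vectorState v a * vectorState v b := by
  simp only [vectorState_apply, mul_apply_eq_comp, sub_apply, map_sub, one_apply_eq_self,
    Submodule.starProjection_unit_singleton ℂ hv, map_smul, inner_sub_right, inner_smul_right,
    mul_comm (inner ℂ v (a v))]

theorem letterSpace_le (ι : Fin 2) :
    letterSpace H ι ≤ supported H (tailWords (bar ι) 2) :=
  supported_mono fun w (hw : w.1 = [ι]) =>
    ⟨⟨0, by rw [hw]; rfl⟩, by rw [hw]; simpa using ne_bar ι⟩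

theorem isSFreePairWithUnit_oddR_evenBarR (x : (i : Fin 2) → H i →L[ℂ] H i) (ι : Fin 2)
    (ζ : sFreeFock H ι) (hζ : (ζ : FreeFock H) ∈ letterSpace H ι) (hζ_norm : ‖ζ‖ = 1) :
    IsSFreePairWithUnit (vectorState (vacuumK H ι)) (vectorState ζ)
      (oddR x ι - 1) (evenBarR x ι - 1) (1 - vacuumProj H ι) where
  phi_one := vectorState_one (norm_vacuumK ι)
  psi_one := vectorState_one hζ_norm
  unit_mem := NonUnitalAlgebra.subset_adjoin ℂ (by simp)
  unit_mul b hb := by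
    rw [sub_mul, one_mul, (exists_actsAs_of_mem_nonUnitalAdjoin x ι hb).2.1, sub_zero]
  mul_unit b hb := by
    rw [mul_sub, mul_one, (exists_actsAs_of_mem_nonUnitalAdjoin x ι hb).2.2, sub_zero]
  psi_unit := by
    rw [(actsAs_one_sub_vacuumProj ι).vectorState_eq (tailWords_subset_avoid _ _) ζ
      (letterSpace_le ι hζ) hζ_norm]
    change inner ℂ (H (bar ι)).vec (H (bar ι)).vec = 1
    rw [inner_self_eq_norm_sq_to_K, (H (bar ι)).norm_vec]
    simp
  alternating l hne hc hl := by
    obtain ⟨p, l, rfl⟩ := List.exists_cons_of_ne_nil hne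
    exact inner_vacuumK (supported_mono (rangeWords_subset ι p.1)
      (prod_vacuumK_mem x ι (letterSpace_le ι hζ) hζ_norm l p hc hl))
  insertion w₁ _ w₂ _ := vectorState_mul_one_sub_mul (norm_vacuumK ι) w₁ w₂

end

end FreeProd

theorem proposition8p2 (H : Fin 2 → PointedHilbertSpace.{u})
    (x : (i : Fin 2) → H i →L[ℂ] H i) (ι : Fin 2)
    (ζ : sFreeFock H ι) (hζ : (ζ : FreeFock H) ∈ letterSpace H ι) (hζ_norm : ‖ζ‖ = 1) :
    IsSFreePair (vectorState (vacuumK H ι)) (vectorState ζ) (oddR x ι - 1) (evenBarR x ι - 1) ∧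
    IsSFreePairWithUnit (vectorState (vacuumK H ι)) (vectorState ζ)
      (oddR x ι - 1) (evenBarR x ι - 1) (1 - vacuumProj H ι) :=
  have h := isSFreePairWithUnit_oddR_evenBarR x ι ζ hζ hζ_norm
  ⟨⟨_, h⟩, h⟩
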